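/- Let $A\in\mathbb R^{m\times n}$ have full row rank $m$, with columns $A_1,\dots,A_n$. For $\lambda\ge 0$ and $b\in\mathbb R^m$ let $S(\lambda,b)\subseteq\mathbb R^n$ be the set of minimizers of $\|x\|_1+\frac1{2\lambda}\|Ax-b\|_2^2$ over $x\in\mathbb R^n$ if $\lambda>0$, and the set of minimizers of $\|x\|_1$ subject to $Ax=b$ if $\lambda=0$. Let $Y^0=\{y\in\mathbb R^m:\|A^\top y\|_\infty\le 1\}$ and let $\mathcal F$ be the set of nonempty faces of $Y^0$, i.e. of nonempty sets of the form $\operatorname{argmax}\{v^\top y: y\in Y^0\}$ with $v\in\mathbb R^m$. For $F\subseteq\mathbb R^m$ put $$\mathcal A^{\pm}(F)=\{i: A_i^\top y=\pm1\ \ \forall y\in F\},\qquad \mathcal A^0(F)=\{i: -1<A_i^\top y<1\ \text{ for some } y\in F\}.$$ For $F\in\mathcal F$ let $D_F$ be the set of all $(\lambda,b)\in\mathbb R\times\mathbb R^m$ with $\lambda\ge 0$ for which there is $x\in\mathbb R^n$ with $$\begin{array}{lll} x_i\ge 0, & A_i^\top(b-Ax)=\lambda & \forall i\in\mathcal A^+(F),\\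 x_i=0, & -\lambda\le A_i^\top(b-Ax)\le\lambda & \forall i\in\mathcal A^0(F),\\ x_i\le 0, & A_i^\top(b-Ax)=-\lambda & \forall i\in\mathcal A^-(F).\end{array}$$ Let $\mathcal F^0$ be the set of those $F\in\mathcal F$ for which the columns $A_i$, $i\in\mathcal A^+(F)\cup\mathcal A^-(F)$, are linearly independent (an empty family being independent). We call $S$ single-valued and linear on a nonempty set $D$ if there is a linear map $L:\mathbb R\times\mathbb R^m\to\mathbb R^n$ with $S(\lambda,b)=\{L(\lambda,b)\}$ for all $(\lambda,b)\in D$. (i) If $F\in\mathcal F^0$, then $S$ is single-valued and linear on $D_F$, and for every $(\lambda,b)\in D_F$ we have $S(\lambda,b)=\{x\}$, where $x$ is the unique solution of the linear system $$A_i^\top Ax=A_i^\top b-\lambda\ \ (i\in\mathcal A^+(F)),\qquad x_i=0\ \ (i\in\mathcal A^0(F)),\qquad A_i^\top Ax=A_i^\top b+\lambda\ \ (i\in\mathcal A^-(F)).$$ If $F\in\mathcal F\setminus\mathcal F^0$, then $S(\lambda,b)$ has more than one element for every $(\lambda,b)$ in the interior of $D_F$. (ii) If $S(\bar\lambda,\bar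 b)=\{\bar x\}$ for some $\bar\lambda\ge0$ and $\bar b\in\mathbb R^m$, then the set $$F=\{y\in\mathbb R^m: A_i^\top y=1\text{ if }\bar x_i>0,\ -1\le A_i^\top y\le 1\text{ if }\bar x_i=0,\ A_i^\top y=-1\text{ if }\bar x_i<0\}$$ belongs to $\mathcal F$, $D_F$ is a polyhedral cone containing $(\bar\lambda,\bar b)$, and $S$ is single-valued and linear on $D_F$. -/

import Mathlib

open scoped Matrix

namespace L1Reg

variable {m n : ℕ}

/-- The feasible set `{y | ‖Aᵀ y‖_∞ ≤ 1}` of the dual problem; the norm on `Fin n → ℝ` is the sup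
norm. -/
def dualFeasible (A : Matrix (Fin m) (Fin n) ℝ) : Set (Fin m → ℝ) :=
  {y | ‖Aᵀ *ᵥ y‖ ≤ 1}

/-- The nonempty faces of the dual feasible set, that is, the nonempty sets of maximizers over it
of a linear functional (possibly zero). -/
def faces (A : Matrix (Fin m) (Fin n) ℝ) : Set (Set (Fin m → ℝ)) :=
  {F | F.Nonempty ∧ IsExposed ℝ (dualFeasible A) F}

/-- The index set `𝒜⁺(F)`. -/
def activePos (A : Matrix (Fin m) (Fin n) ℝ) (F : Set (Fin m → ℝ)) : Set (Fin n) :=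
  {i | ∀ y ∈ F, A.col i ⬝ᵥ y = 1}

/-- The index set `𝒜⁻(F)`. -/
def activeNeg (A : Matrix (Fin m) (Fin n) ℝ) (F : Set (Fin m → ℝ)) : Set (Fin n) :=
  {i | ∀ y ∈ F, A.col i ⬝ᵥ y = -1}

/-- The index set `𝒜⁰(F)`. -/
def activeZero (A : Matrix (Fin m) (Fin n) ℝ) (F : Set (Fin m → ℝ)) : Set (Fin n) :=
  {i | ∃ y ∈ F, -1 < A.col i ⬝ᵥ y ∧ A.col i ⬝ᵥ y < 1}

/-- The family `𝓕⁰` of nonempty faces `F` such that the columns of `A` with index in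
`𝒜⁺(F) ∪ 𝒜⁻(F)` are linearly independent (as a family). -/
def independentFaces (A : Matrix (Fin m) (Fin n) ℝ) : Set (Set (Fin m → ℝ)) :=
  {F | F ∈ faces A ∧ LinearIndepOn ℝ A.col (activePos A F ∪ activeNeg A F)}

/-- The polyhedral cone `S_F` of triples `(λ, b, x)`. -/
def coneS (A : Matrix (Fin m) (Fin n) ℝ) (F : Set (Fin m → ℝ)) :
    Set (ℝ × (Fin m → ℝ) × (Fin n → ℝ)) :=
  {p | 0 ≤ p.1 ∧
    (∀ i ∈ activePos A F, 0 ≤ p.2.2 i ∧ A.col i ⬝ᵥ (p.2.1 - A *ᵥ p.2.2) = p.1) ∧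
    (∀ i ∈ activeZero A F, p.2.2 i = 0 ∧ -p.1 ≤ A.col i ⬝ᵥ (p.2.1 - A *ᵥ p.2.2) ∧
      A.col i ⬝ᵥ (p.2.1 - A *ᵥ p.2.2) ≤ p.1) ∧
    (∀ i ∈ activeNeg A F, p.2.2 i ≤ 0 ∧ A.col i ⬝ᵥ (p.2.1 - A *ᵥ p.2.2) = -p.1)}

/-- The projection `D_F` of `S_F` onto the parameters `(λ, b)`. -/
def coneD (A : Matrix (Fin m) (Fin n) ℝ) (F : Set (Fin m → ℝ)) : Set (ℝ × (Fin m → ℝ)) :=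
  (fun p => (p.1, p.2.1)) '' coneS A F

/-- The objective `‖x‖₁ + (1 / (2λ)) ‖A x - b‖₂²`, used for `λ > 0`. -/
noncomputable def objective (A : Matrix (Fin m) (Fin n) ℝ) (lam : ℝ) (b : Fin m → ℝ)
    (x : Fin n → ℝ) : ℝ :=
  ‖WithLp.toLp 1 x‖ + 1 / (2 * lam) * ‖WithLp.toLp 2 (A *ᵥ x - b)‖ ^ 2

/-- The solution multifunction `S` at `p = (λ, b)`: the minimizers of the objective over all `x` if
`λ > 0`, and the minimizers of `‖x‖₁` subject to `A x = b` if `λ = 0`. It has domain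
`{(λ, b) | 0 ≤ λ}`, and is empty outside. -/
def solutionSet (A : Matrix (Fin m) (Fin n) ℝ) (p : ℝ × (Fin m → ℝ)) : Set (Fin n → ℝ) :=
  {x | (0 < p.1 ∧ ∀ z : Fin n → ℝ, objective A p.1 p.2 x ≤ objective A p.1 p.2 z) ∨
    (p.1 = 0 ∧ A *ᵥ x = p.2 ∧
      ∀ z : Fin n → ℝ, A *ᵥ z = p.2 → ‖WithLp.toLp 1 x‖ ≤ ‖WithLp.toLp 1 z‖)}

/-- The multifunction `S` is single-valued on the nonempty set `D`, and agrees there with a linear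
map. -/
def SingleValuedLinearOn (S : ℝ × (Fin m → ℝ) → Set (Fin n → ℝ)) (D : Set (ℝ × (Fin m → ℝ))) :
    Prop :=
  D.Nonempty ∧ ∃ L : ℝ × (Fin m → ℝ) →ₗ[ℝ] (Fin n → ℝ), ∀ p ∈ D, S p = {L p}

/-- The linear system for `x` associated with the face `F` and the parameters `(λ, b)`. -/
def SolvesSystem (A : Matrix (Fin m) (Fin n) ℝ) (F : Set (Fin m → ℝ)) (p : ℝ × (Fin m → ℝ))
    (x : Fin n → ℝ) : Prop :=
  (∀ i ∈ activePos A F, A.col i ⬝ᵥ (A *ᵥ x) = A.col i ⬝ᵥ p.2 - p.1) ∧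
  (∀ i ∈ activeZero A F, x i = 0) ∧
  (∀ i ∈ activeNeg A F, A.col i ⬝ᵥ (A *ᵥ x) = A.col i ⬝ᵥ p.2 + p.1)

/-- The subset of the dual feasible set determined by the signs of `x`. -/
def signFace (A : Matrix (Fin m) (Fin n) ℝ) (x : Fin n → ℝ) : Set (Fin m → ℝ) :=
  {y | (∀ i, 0 < x i → A.col i ⬝ᵥ y = 1) ∧
    (∀ i, x i = 0 → -1 ≤ A.col i ⬝ᵥ y ∧ A.col i ⬝ᵥ y ≤ 1) ∧
    (∀ i, x i < 0 → A.col i ⬝ᵥ y = -1)}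

/-- A polyhedral cone: the solution set of finitely many linear inequalities that contains `0` and
is closed under multiplication by positive scalars. -/
def IsPolyhedralCone {E : Type*} [AddCommGroup E] [Module ℝ E] (C : Set E) : Prop :=
  (∃ (k : ℕ) (a : Fin k → (E →ₗ[ℝ] ℝ)) (c : Fin k → ℝ), C = {z | ∀ j, a j z ≤ c j}) ∧
  (0 : E) ∈ C ∧ ∀ t : ℝ, 0 < t → ∀ z ∈ C, t • z ∈ C

end L1Reg

namespace L1Reg

variable {m n : ℕ} {A : Matrix (Fin m) (Fin n) ℝ} {F : Set (Fin m → ℝ)}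

/-! For `(λ, b, x)` in the cone of a face `F`, the residual `b - A x` is `λ` times a dual
certificate for `x`, so `x` is optimal by weak duality. When `λ = 0` full row rank makes the
residual vanish, and any `y ∈ F` is the certificate. All solutions share `A x` and the `ℓ¹` norm
(`solution_invariants`). A point of `F` where a constraint is slack forces that coordinate of every
solution to be zero, and independence of the active columns then settles uniqueness. The linear
system has at most one solution, hence that solution is linear in `(λ, b)`. If the active columns
are dependent, an interior parameter admits a solution with strict signs, which can be moved along a
kernel vector.

For the converse part, a unique solution `x` strictly minimizes the `ℓ¹` norm on `{z | A z = A x}`.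
Compactness and Hahn–Banach turn this into a dual vector that is strict off the support of `x`
(`exists_strict_certificate`). Therefore the active sets of `signFace A x` are exactly the sign
pattern of `x`, the face is independent, and the first part applies. -/

/-! ### Norms, pairings and the active sets of a face. -/

theorem norm_toLp_one (x : Fin n → ℝ) : ‖WithLp.toLp 1 x‖ = ∑ i, |x i| := by
  simp [PiLp.norm_eq_of_L1]

theorem norm_toLp_two_sq (v : Fin m → ℝ) : ‖WithLp.toLp 2 v‖ ^ 2 = v ⬝ᵥ v := by
  rw [EuclideanSpace.norm_sq_eq]
  simp [dotProduct, sq]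

theorem objective_eq (lam : ℝ) (b : Fin m → ℝ) (x : Fin n → ℝ) :
    objective A lam b x = ∑ i, |x i| + 1 / (2 * lam) * ((A *ᵥ x - b) ⬝ᵥ (A *ᵥ x - b)) := by
  rw [objective, norm_toLp_one, norm_toLp_two_sq]

theorem dotProduct_mulVec_eq_sum (A : Matrix (Fin m) (Fin n) ℝ) (y : Fin m → ℝ)
    (x : Fin n → ℝ) : y ⬝ᵥ (A *ᵥ x) = ∑ i, (A.col i ⬝ᵥ y) * x i := by
  rw [Matrix.dotProduct_mulVec]
  simp only [dotProduct, Matrix.vecMul, Matrix.col_apply]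
  simp only [mul_comm]

theorem mem_dualFeasible {y : Fin m → ℝ} :
    y ∈ dualFeasible A ↔ ∀ i, |A.col i ⬝ᵥ y| ≤ 1 := by
  rw [dualFeasible, Set.mem_ofPred_eq, pi_norm_le_iff_of_nonneg zero_le_one]
  rfl

theorem convex_dualFeasible (A : Matrix (Fin m) (Fin n) ℝ) : Convex ℝ (dualFeasible A) := by
  intro y hy z hz a b ha hb hab
  rw [mem_dualFeasible] at hy hz ⊢
  intro i
  have h1 := abs_le.1 (hy i)
  have h2 := abs_le.1 (hz i)
  rw [dotProduct_add, dotProduct_smul, dotProduct_smul, smul_eq_mul, smul_eq_mul, abs_le]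
  constructor <;> nlinarith

theorem eq_zero_of_col_dotProduct_eq_zero (hA : A.rank = m) {r : Fin m → ℝ}
    (hr : ∀ i, A.col i ⬝ᵥ r = 0) : r = 0 := by
  have hinj : Function.Injective Aᵀ.mulVecLin := by
    rw [← LinearMap.ker_eq_bot, ← Submodule.finrank_eq_zero]
    have h := Aᵀ.mulVecLin.finrank_range_add_finrank_ker
    have h2 : Module.finrank ℝ (LinearMap.range Aᵀ.mulVecLin) = m :=
      show Aᵀ.rank = m by rw [Matrix.rank_transpose, hA]
    rw [h2, Module.finrank_fin_fun] at h
    omega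
  apply hinj
  rw [map_zero]
  ext i
  exact hr i

theorem abs_col_le_of_mem_faces (hF : F ∈ faces A) {y : Fin m → ℝ} (hy : y ∈ F) (i : Fin n) :
    |A.col i ⬝ᵥ y| ≤ 1 :=
  mem_dualFeasible.1 (hF.2.subset hy) i

/-- Faces are convex: if only the values `1` and `-1` occurred and both did, the midpoint of two
such points would give the value `0`. -/
theorem active_cases (hF : F ∈ faces A) (i : Fin n) :
    i ∈ activePos A F ∨ i ∈ activeZero A F ∨ i ∈ activeNeg A F := by
  by_contra! h
  obtain ⟨h1, h2, h3⟩ := h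
  have hc : Convex ℝ F := hF.2.convex (convex_dualFeasible A)
  have key : ∀ y ∈ F, A.col i ⬝ᵥ y = 1 ∨ A.col i ⬝ᵥ y = -1 := by
    intro y hy
    have h := abs_le.1 (abs_col_le_of_mem_faces hF hy i)
    by_contra! hne
    exact h2 ⟨y, hy, lt_of_le_of_ne h.1 (Ne.symm hne.2), lt_of_le_of_ne h.2 hne.1⟩
  simp only [activePos, activeNeg, Set.mem_ofPred_eq, not_forall] at h1 h3
  obtain ⟨y, hy, hy1⟩ := h1
  obtain ⟨z, hz, hz1⟩ := h3
  have hy2 := (key y hy).resolve_left hy1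
  have hz2 := (key z hz).resolve_right hz1
  refine h2 ⟨(1 / 2 : ℝ) • y + (1 / 2 : ℝ) • z,
    hc hy hz (by norm_num) (by norm_num) (by norm_num), ?_⟩
  rw [dotProduct_add, dotProduct_smul, dotProduct_smul, hy2, hz2]
  norm_num

theorem notMem_activeZero_of_mem_activePos {i : Fin n} (hi : i ∈ activePos A F) :
    i ∉ activeZero A F := by
  rintro ⟨y, hy, -, h⟩
  exact h.ne (hi y hy)

theorem notMem_activeZero_of_mem_activeNeg {i : Fin n} (hi : i ∈ activeNeg A F) :
    i ∉ activeZero A F := by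
  rintro ⟨y, hy, h, -⟩
  exact h.ne (hi y hy).symm

theorem notMem_activeNeg_of_mem_activePos (hF : F.Nonempty) {i : Fin n}
    (hi : i ∈ activePos A F) : i ∉ activeNeg A F := by
  intro h
  obtain ⟨y, hy⟩ := hF
  linarith [hi y hy, h y hy]

/-! ### Optimality and invariants of solutions. -/

/-- Weak duality: a dual feasible vector bounds the `ℓ¹` norm from below. -/
theorem dotProduct_mulVec_le {y : Fin m → ℝ} {c : ℝ} (hy : ∀ i, |A.col i ⬝ᵥ y| ≤ c)
    (z : Fin n → ℝ) : y ⬝ᵥ (A *ᵥ z) ≤ c * ∑ i, |z i| := by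
  rw [dotProduct_mulVec_eq_sum, Finset.mul_sum]
  refine Finset.sum_le_sum fun i _ => (le_abs_self _).trans ?_
  rw [abs_mul]
  exact mul_le_mul_of_nonneg_right (hy i) (abs_nonneg _)

theorem coneS_abs_sum_eq (hF : F ∈ faces A) {p : ℝ × (Fin m → ℝ)} {x : Fin n → ℝ}
    (hx : (p.1, p.2, x) ∈ coneS A F) {y : Fin m → ℝ} (hy : y ∈ F) :
    ∑ i, |x i| = y ⬝ᵥ (A *ᵥ x) := by
  obtain ⟨-, h1, h2, h3⟩ := hx
  rw [dotProduct_mulVec_eq_sum]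
  refine Finset.sum_congr rfl fun i _ => ?_
  rcases active_cases hF i with hi | hi | hi
  · rw [hi y hy, one_mul, abs_of_nonneg (h1 i hi).1]
  · have : x i = 0 := (h2 i hi).1
    simp [this]
  · rw [hi y hy, abs_of_nonpos (h3 i hi).1]
    simp

theorem coneS_abs_residual_le (hF : F ∈ faces A) {p : ℝ × (Fin m → ℝ)} {x : Fin n → ℝ}
    (hx : (p.1, p.2, x) ∈ coneS A F) (i : Fin n) : |A.col i ⬝ᵥ (p.2 - A *ᵥ x)| ≤ p.1 := by
  obtain ⟨h0, h1, h2, h3⟩ := hx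
  replace h0 : 0 ≤ p.1 := h0
  rcases active_cases hF i with hi | hi | hi
  · have := (h1 i hi).2
    simp only at this
    rw [this, abs_of_nonneg h0]
  · exact abs_le.2 (h2 i hi).2
  · have := (h3 i hi).2
    simp only at this
    rw [this, abs_neg, abs_of_nonneg h0]

theorem coneS_mul_abs_sum_eq (hF : F ∈ faces A) {p : ℝ × (Fin m → ℝ)} {x : Fin n → ℝ}
    (hx : (p.1, p.2, x) ∈ coneS A F) :
    p.1 * ∑ i, |x i| = (p.2 - A *ᵥ x) ⬝ᵥ (A *ᵥ x) := by
  obtain ⟨h0, h1, h2, h3⟩ := hx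
  rw [dotProduct_mulVec_eq_sum, Finset.mul_sum]
  refine Finset.sum_congr rfl fun i _ => ?_
  rcases active_cases hF i with hi | hi | hi
  · have := h1 i hi
    simp only at this
    rw [this.2, abs_of_nonneg this.1]
  · have : x i = 0 := (h2 i hi).1
    simp [this]
  · have := h3 i hi
    simp only at this
    rw [this.2, abs_of_nonpos this.1]
    ring

theorem coneS_residual_eq_zero (hA : A.rank = m) (hF : F ∈ faces A) {p : ℝ × (Fin m → ℝ)}
    {x : Fin n → ℝ} (hx : (p.1, p.2, x) ∈ coneS A F) (hp : p.1 = 0) : A *ᵥ x = p.2 := by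
  have : p.2 - A *ᵥ x = 0 := by
    refine eq_zero_of_col_dotProduct_eq_zero hA fun i => ?_
    have := coneS_abs_residual_le hF hx i
    rw [hp] at this
    exact abs_nonpos_iff.1 this
  exact (sub_eq_zero.1 this).symm

/-- The residual divided by `λ` is a subgradient of the `ℓ¹` norm at `x`; expanding the quadratic
exactly keeps the second-order term, which later pins down `A z`. -/
theorem objective_gap (hF : F ∈ faces A) {p : ℝ × (Fin m → ℝ)} {x : Fin n → ℝ}
    (hx : (p.1, p.2, x) ∈ coneS A F) (hp : 0 < p.1) (z : Fin n → ℝ) :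
    objective A p.1 p.2 x + 1 / (2 * p.1) * ((A *ᵥ z - A *ᵥ x) ⬝ᵥ (A *ᵥ z - A *ᵥ x)) ≤
      objective A p.1 p.2 z := by
  have h1 := coneS_mul_abs_sum_eq hF hx
  have h2 := dotProduct_mulVec_le (coneS_abs_residual_le hF hx) z
  rw [objective_eq, objective_eq]
  have e : (A *ᵥ z - p.2) ⬝ᵥ (A *ᵥ z - p.2) = (A *ᵥ x - p.2) ⬝ᵥ (A *ᵥ x - p.2) +
      (A *ᵥ z - A *ᵥ x) ⬝ᵥ (A *ᵥ z - A *ᵥ x) -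
      2 * ((p.2 - A *ᵥ x) ⬝ᵥ (A *ᵥ z) - (p.2 - A *ᵥ x) ⬝ᵥ (A *ᵥ x)) := by
    simp only [sub_dotProduct, dotProduct_sub]
    rw [dotProduct_comm (A *ᵥ x) (A *ᵥ z), dotProduct_comm p.2 (A *ᵥ z),
      dotProduct_comm p.2 (A *ᵥ x)]
    ring
  rw [e, ← h1]
  have h3 : (p.2 - A *ᵥ x) ⬝ᵥ (A *ᵥ z) / p.1 ≤ ∑ i, |z i| := by
    rw [div_le_iff₀ hp, mul_comm]
    exact h2
  have e2 : 1 / (2 * p.1) * ((A *ᵥ x - p.2) ⬝ᵥ (A *ᵥ x - p.2) +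
      (A *ᵥ z - A *ᵥ x) ⬝ᵥ (A *ᵥ z - A *ᵥ x) -
      2 * ((p.2 - A *ᵥ x) ⬝ᵥ (A *ᵥ z) - p.1 * ∑ i, |x i|)) =
      1 / (2 * p.1) * ((A *ᵥ x - p.2) ⬝ᵥ (A *ᵥ x - p.2)) +
      1 / (2 * p.1) * ((A *ᵥ z - A *ᵥ x) ⬝ᵥ (A *ᵥ z - A *ᵥ x)) -
      (p.2 - A *ᵥ x) ⬝ᵥ (A *ᵥ z) / p.1 + ∑ i, |x i| := by
    field_simp
    ring
  rw [e2]
  linarith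

theorem dotProduct_self_nonneg_real (v : Fin m → ℝ) : 0 ≤ v ⬝ᵥ v :=
  Finset.sum_nonneg fun i _ => mul_self_nonneg (v i)

theorem mem_solutionSet_of_coneS (hA : A.rank = m) (hF : F ∈ faces A) {p : ℝ × (Fin m → ℝ)}
    {x : Fin n → ℝ} (hx : (p.1, p.2, x) ∈ coneS A F) : x ∈ solutionSet A p := by
  rcases (show 0 ≤ p.1 from hx.1).eq_or_lt with hp | hp
  · have hb := coneS_residual_eq_zero hA hF hx hp.symm
    refine Or.inr ⟨hp.symm, hb, fun z hz => ?_⟩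
    obtain ⟨y, hy⟩ := hF.1
    rw [norm_toLp_one, norm_toLp_one, coneS_abs_sum_eq hF hx hy, hb, ← hz]
    simpa using dotProduct_mulVec_le (abs_col_le_of_mem_faces hF hy) z
  · refine Or.inl ⟨hp, fun z => ?_⟩
    have := objective_gap hF hx hp z
    have h := dotProduct_self_nonneg_real (A *ᵥ z - A *ᵥ x)
    have : 0 ≤ 1 / (2 * p.1) * ((A *ᵥ z - A *ᵥ x) ⬝ᵥ (A *ᵥ z - A *ᵥ x)) := by positivity
    linarith

/-- All solutions have the same image under `A` and the same `ℓ¹` norm. -/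
theorem solution_invariants (hA : A.rank = m) (hF : F ∈ faces A) {p : ℝ × (Fin m → ℝ)}
    {x z : Fin n → ℝ} (hx : (p.1, p.2, x) ∈ coneS A F) (hz : z ∈ solutionSet A p) :
    A *ᵥ z = A *ᵥ x ∧ ∑ i, |z i| = ∑ i, |x i| := by
  rcases mem_solutionSet_of_coneS hA hF hx with ⟨hp, hx'⟩ | ⟨hp, hb, hx'⟩
  · rcases hz with ⟨-, hz⟩ | ⟨h, -⟩
    · have h1 := objective_gap hF hx hp z
      have h2 := hz x
      have h := dotProduct_self_nonneg_real (A *ᵥ z - A *ᵥ x)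
      have h3 : (A *ᵥ z - A *ᵥ x) ⬝ᵥ (A *ᵥ z - A *ᵥ x) = 0 := by
        by_contra hne
        have : 0 < (A *ᵥ z - A *ᵥ x) ⬝ᵥ (A *ᵥ z - A *ᵥ x) := lt_of_le_of_ne h (Ne.symm hne)
        have : 0 < 1 / (2 * p.1) * ((A *ᵥ z - A *ᵥ x) ⬝ᵥ (A *ᵥ z - A *ᵥ x)) := by positivity
        linarith
      have h4 : A *ᵥ z = A *ᵥ x := sub_eq_zero.1 (dotProduct_self_eq_zero.1 h3)
      have h5 := hx' z
      rw [objective_eq, objective_eq, h4] at h2 h5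
      exact ⟨h4, by linarith⟩
    · exact absurd h hp.ne'
  · rcases hz with ⟨h, -⟩ | ⟨-, hzb, hz⟩
    · exact absurd hp h.ne'
    · refine ⟨hzb.trans hb.symm, ?_⟩
      have h1 := hz x hb
      have h2 := hx' z hzb
      rw [norm_toLp_one, norm_toLp_one] at h1 h2
      exact le_antisymm h1 h2

/-- Every `y ∈ F` gives equality in weak duality for `z` as well, hence equality term by term; a `y`
that is slack at `i` leaves no room for `z i ≠ 0`. -/
theorem solution_eq_zero_on_activeZero (hA : A.rank = m) (hF : F ∈ faces A)
    {p : ℝ × (Fin m → ℝ)} {x z : Fin n → ℝ} (hx : (p.1, p.2, x) ∈ coneS A F)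
    (hz : z ∈ solutionSet A p) {i : Fin n} (hi : i ∈ activeZero A F) : z i = 0 := by
  obtain ⟨hAz, hn⟩ := solution_invariants hA hF hx hz
  obtain ⟨y, hy, hy1, hy2⟩ := hi
  have h : ∑ j, |z j| = ∑ j, (A.col j ⬝ᵥ y) * z j := by
    rw [hn, coneS_abs_sum_eq hF hx hy, ← hAz, dotProduct_mulVec_eq_sum]
  have hle : ∀ j ∈ Finset.univ, (A.col j ⬝ᵥ y) * z j ≤ |z j| := fun j _ => by
    refine (le_abs_self _).trans ?_
    rw [abs_mul]
    exact mul_le_of_le_one_left (abs_nonneg _) (abs_col_le_of_mem_faces hF hy j)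
  have he := (Finset.sum_eq_sum_iff_of_le hle).1 h.symm i (Finset.mem_univ i)
  by_contra hne
  have h1 : |A.col i ⬝ᵥ y| < 1 := abs_lt.2 ⟨hy1, hy2⟩
  have h2 : 0 < |z i| := abs_pos.2 hne
  have h3 : |A.col i ⬝ᵥ y| * |z i| < |z i| := by nlinarith
  rw [← abs_mul] at h3
  linarith [le_abs_self ((A.col i ⬝ᵥ y) * z i)]

/-! ### Independent columns and the linear system. -/

theorem eq_zero_of_linearIndepOn {s : Set (Fin n)} (h : LinearIndepOn ℝ A.col s)
    {w : Fin n → ℝ} (hw : ∀ i, i ∉ s → w i = 0) (hAw : A *ᵥ w = 0) : w = 0 := by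
  classical
  rw [linearIndepOn_iff'] at h
  ext i
  by_cases hi : i ∈ s
  · refine h (Finset.univ.filter (· ∈ s)) w (by intro j; simp) ?_ i (by simpa using hi)
    rw [← hAw, Matrix.mulVec_eq_sum, Finset.sum_filter]
    refine Finset.sum_congr rfl fun j _ => ?_
    split_ifs with hj
    · ext k; simp [Matrix.col, mul_comm]
    · rw [hw j hj]; simp
  · exact hw i hi

theorem exists_ne_zero_of_not_linearIndepOn {s : Set (Fin n)} (h : ¬ LinearIndepOn ℝ A.col s) :
    ∃ w : Fin n → ℝ, (∀ i, i ∉ s → w i = 0) ∧ A *ᵥ w = 0 ∧ w ≠ 0 := by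
  classical
  rw [linearIndepOn_iff'] at h
  push Not at h
  obtain ⟨t, g, hts, hsum, i, hi, hne⟩ := h
  refine ⟨fun j => if j ∈ t then g j else 0, ?_, ?_, ?_⟩
  · intro j hj
    exact if_neg fun hjt => hj (hts hjt)
  · rw [Matrix.mulVec_eq_sum, ← hsum, ← Finset.sum_filter_add_sum_filter_not Finset.univ (· ∈ t)]
    rw [Finset.filter_mem_eq_inter, Finset.univ_inter]
    rw [Finset.sum_eq_zero (s := Finset.univ.filter (· ∉ t)), add_zero]
    · refine Finset.sum_congr rfl fun j hj => ?_
      ext k; simp [hj, Matrix.col, mul_comm]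
    · intro j hj
      simp at hj
      simp [hj]
  · intro h0
    have := congrFun h0 i
    simp [hi] at this
    exact hne this

theorem solvesSystem_of_coneS {p : ℝ × (Fin m → ℝ)} {x : Fin n → ℝ}
    (hx : (p.1, p.2, x) ∈ coneS A F) : SolvesSystem A F p x := by
  obtain ⟨-, h1, h2, h3⟩ := hx
  refine ⟨fun i hi => ?_, fun i hi => (h2 i hi).1, fun i hi => ?_⟩
  · have := (h1 i hi).2
    simp only [dotProduct_sub] at this
    linarith
  · have := (h3 i hi).2
    simp only [dotProduct_sub] at this
    linarith

/-- In the homogeneous system each product `(A_i · A x) x_i` has a vanishing factor, so `‖A x‖² =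
0`. -/
theorem SolvesSystem.eq_zero (hF : F ∈ independentFaces A) {x : Fin n → ℝ}
    (hx : SolvesSystem A F 0 x) : x = 0 := by
  obtain ⟨h1, h2, h3⟩ := hx
  refine eq_zero_of_linearIndepOn hF.2 (fun i hi => h2 i ?_) ?_
  · rcases active_cases hF.1 i with h | h | h
    · exact absurd (Or.inl h) hi
    · exact h
    · exact absurd (Or.inr h) hi
  · rw [← dotProduct_self_eq_zero, dotProduct_mulVec_eq_sum]
    refine Finset.sum_eq_zero fun i _ => ?_
    rcases active_cases hF.1 i with h | h | h
    · simp [h1 i h]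
    · simp [h2 i h]
    · simp [h3 i h]

/-- The solutions of the linear system, as a subspace of pairs of parameters and solutions. -/
def systemSubmodule (A : Matrix (Fin m) (Fin n) ℝ) (F : Set (Fin m → ℝ)) :
    Submodule ℝ ((ℝ × (Fin m → ℝ)) × (Fin n → ℝ)) where
  carrier := {q | SolvesSystem A F q.1 q.2}
  zero_mem' := by simp [SolvesSystem]
  add_mem' := by
    rintro q r ⟨h1, h2, h3⟩ ⟨k1, k2, k3⟩
    refine ⟨fun i hi => ?_, fun i hi => ?_, fun i hi => ?_⟩
    · simp only [Prod.fst_add, Prod.snd_add, Matrix.mulVec_add, dotProduct_add, h1 i hi, k1 i hi]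
      ring
    · simp [h2 i hi, k2 i hi]
    · simp only [Prod.fst_add, Prod.snd_add, Matrix.mulVec_add, dotProduct_add, h3 i hi, k3 i hi]
      ring
  smul_mem' := by
    rintro c q ⟨h1, h2, h3⟩
    refine ⟨fun i hi => ?_, fun i hi => ?_, fun i hi => ?_⟩
    · simp only [Prod.smul_fst, Prod.smul_snd, Matrix.mulVec_smul, dotProduct_smul, h1 i hi,
        smul_eq_mul]
      ring
    · simp [h2 i hi]
    · simp only [Prod.smul_fst, Prod.smul_snd, Matrix.mulVec_smul, dotProduct_smul, h3 i hi,
        smul_eq_mul]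
      ring

/-- Such a subspace is the graph of a partially defined linear map, which extends to all of `E`;
solvability for every parameter is never needed. -/
theorem exists_linearMap_of_submodule {E V : Type*} [AddCommGroup E] [Module ℝ E]
    [AddCommGroup V] [Module ℝ V] (g : Submodule ℝ (E × V))
    (hg : ∀ q ∈ g, q.1 = 0 → q.2 = 0) : ∃ L : E →ₗ[ℝ] V, ∀ q ∈ g, q.2 = L q.1 := by
  obtain ⟨L, hL⟩ := LinearMap.exists_extend g.toLinearPMap.toFun
  refine ⟨L, fun q hq => ?_⟩
  rw [← Submodule.toLinearPMap_graph_eq g hg, LinearPMap.mem_graph_iff] at hq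
  obtain ⟨e, he1, he2⟩ := hq
  rw [← he1, ← he2]
  exact (LinearMap.congr_fun hL e).symm

theorem SolvesSystem.unique (hF : F ∈ independentFaces A) {p : ℝ × (Fin m → ℝ)}
    {x x' : Fin n → ℝ} (hx : SolvesSystem A F p x) (hx' : SolvesSystem A F p x') : x' = x := by
  have h := (systemSubmodule A F).sub_mem (show (p, x') ∈ systemSubmodule A F from hx')
    (show (p, x) ∈ systemSubmodule A F from hx)
  have h' : SolvesSystem A F (p - p) (x' - x) := h
  rw [sub_self] at h'
  exact sub_eq_zero.1 (h'.eq_zero hF)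

theorem exists_linear_solution (hF : F ∈ independentFaces A) :
    ∃ L : ℝ × (Fin m → ℝ) →ₗ[ℝ] (Fin n → ℝ), ∀ p x, SolvesSystem A F p x → x = L p := by
  obtain ⟨L, hL⟩ := exists_linearMap_of_submodule (systemSubmodule A F) (by
    rintro ⟨p, x⟩ hq (rfl : p = 0)
    exact SolvesSystem.eq_zero hF hq)
  exact ⟨L, fun p x h => hL (p, x) h⟩

theorem solutionSet_eq_singleton (hA : A.rank = m) (hF : F ∈ independentFaces A)
    {p : ℝ × (Fin m → ℝ)} {x : Fin n → ℝ} (hx : (p.1, p.2, x) ∈ coneS A F) :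
    solutionSet A p = {x} := by
  refine Set.eq_singleton_iff_unique_mem.2 ⟨mem_solutionSet_of_coneS hA hF.1 hx, fun z hz => ?_⟩
  refine sub_eq_zero.1 (eq_zero_of_linearIndepOn hF.2 (fun i hi => ?_) ?_)
  · have hi0 : i ∈ activeZero A F := by
      rcases active_cases hF.1 i with h | h | h
      · exact absurd (Or.inl h) hi
      · exact h
      · exact absurd (Or.inr h) hi
    have : x i = 0 := (hx.2.2.1 i hi0).1
    rw [Pi.sub_apply, this, solution_eq_zero_on_activeZero hA hF.1 hx hz hi0, sub_zero]
  · rw [Matrix.mulVec_sub, (solution_invariants hA hF.1 hx hz).1, sub_self]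

/-! ### Cone structure and linearity on independent faces. -/

theorem mem_coneD {p : ℝ × (Fin m → ℝ)} :
    p ∈ coneD A F ↔ ∃ x, (p.1, p.2, x) ∈ coneS A F := by
  constructor
  · rintro ⟨⟨l, b, x⟩, hq, rfl⟩
    exact ⟨x, hq⟩
  · rintro ⟨x, hx⟩
    exact ⟨_, hx, rfl⟩

theorem zero_mem_coneS : ((0 : ℝ), (0 : Fin m → ℝ), (0 : Fin n → ℝ)) ∈ coneS A F := by
  simp [coneS]

theorem add_mem_coneS {q r : ℝ × (Fin m → ℝ) × (Fin n → ℝ)} (hq : q ∈ coneS A F)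
    (hr : r ∈ coneS A F) : q + r ∈ coneS A F := by
  obtain ⟨h0, h1, h2, h3⟩ := hq
  obtain ⟨k0, k1, k2, k3⟩ := hr
  have e : ∀ i, A.col i ⬝ᵥ ((q + r).2.1 - A *ᵥ (q + r).2.2) =
      A.col i ⬝ᵥ (q.2.1 - A *ᵥ q.2.2) + A.col i ⬝ᵥ (r.2.1 - A *ᵥ r.2.2) := by
    intro i
    simp only [Prod.snd_add, Prod.fst_add, Matrix.mulVec_add, dotProduct_add, dotProduct_sub]
    ring
  refine ⟨add_nonneg h0 k0, fun i hi => ?_, fun i hi => ?_, fun i hi => ?_⟩ <;> rw [e] <;>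
    simp only [Prod.snd_add, Prod.fst_add, Pi.add_apply]
  · have := h1 i hi
    have := k1 i hi
    constructor <;> linarith
  · have := h2 i hi
    have := k2 i hi
    refine ⟨?_, ?_, ?_⟩ <;> linarith
  · have := h3 i hi
    have := k3 i hi
    constructor <;> linarith

theorem smul_mem_coneS {t : ℝ} (ht : 0 ≤ t) {q : ℝ × (Fin m → ℝ) × (Fin n → ℝ)}
    (hq : q ∈ coneS A F) : t • q ∈ coneS A F := by
  obtain ⟨h0, h1, h2, h3⟩ := hq
  have e : ∀ i, A.col i ⬝ᵥ ((t • q).2.1 - A *ᵥ (t • q).2.2) =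
      t * (A.col i ⬝ᵥ (q.2.1 - A *ᵥ q.2.2)) := by
    intro i
    simp only [Prod.smul_snd, Prod.smul_fst, Matrix.mulVec_smul, dotProduct_smul, dotProduct_sub,
      smul_eq_mul]
    ring
  refine ⟨mul_nonneg ht h0, fun i hi => ?_, fun i hi => ?_, fun i hi => ?_⟩ <;> rw [e] <;>
    simp only [Prod.smul_snd, Prod.smul_fst, Pi.smul_apply, smul_eq_mul]
  · have := h1 i hi
    exact ⟨mul_nonneg ht this.1, by rw [this.2]⟩
  · have := h2 i hi
    exact ⟨by rw [this.1, mul_zero], by nlinarith [this.2.1], by nlinarith [this.2.2]⟩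
  · have := h3 i hi
    exact ⟨mul_nonpos_of_nonneg_of_nonpos ht this.1, by rw [this.2, mul_neg]⟩

theorem coneD_nonempty (A : Matrix (Fin m) (Fin n) ℝ) (F : Set (Fin m → ℝ)) :
    (coneD A F).Nonempty :=
  ⟨0, mem_coneD.2 ⟨0, zero_mem_coneS⟩⟩

theorem singleValuedLinearOn_coneD (hA : A.rank = m) (hF : F ∈ independentFaces A) :
    SingleValuedLinearOn (solutionSet A) (coneD A F) := by
  obtain ⟨L, hL⟩ := exists_linear_solution hF
  refine ⟨coneD_nonempty A F, L, fun p hp => ?_⟩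
  obtain ⟨x, hx⟩ := mem_coneD.1 hp
  rw [solutionSet_eq_singleton hA hF hx, hL p x (solvesSystem_of_coneS hx)]

/-! ### Non-uniqueness for dependent faces. -/

/-- Every face admits a point of its cone whose active coordinates are nonzero. -/
theorem exists_strict_mem_coneS (hF : F ∈ faces A) :
    ∃ b x, ((1 : ℝ), b, x) ∈ coneS A F ∧ (∀ i ∈ activePos A F, 0 < x i) ∧
      ∀ i ∈ activeNeg A F, x i < 0 := by
  classical
  obtain ⟨y, hy⟩ := hF.1
  set x : Fin n → ℝ := fun i => if i ∈ activePos A F then 1 else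
    if i ∈ activeNeg A F then -1 else 0
  have hpos : ∀ i ∈ activePos A F, x i = 1 := fun i hi => by simp [x, hi]
  have hneg : ∀ i ∈ activeNeg A F, x i = -1 := fun i hi => by
    have : i ∉ activePos A F := fun h => notMem_activeNeg_of_mem_activePos hF.1 h hi
    simp [x, hi, this]
  have hzero : ∀ i ∈ activeZero A F, x i = 0 := fun i hi => by
    have h1 : i ∉ activePos A F := fun h => notMem_activeZero_of_mem_activePos h hi
    have h2 : i ∉ activeNeg A F := fun h => notMem_activeZero_of_mem_activeNeg h hi
    simp [x, h1, h2]
  -- With `λ = 1` this choice of `b` makes the residual equal to `y ∈ F`.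
  refine ⟨A *ᵥ x + y, x, ⟨zero_le_one, fun i hi => ?_, fun i hi => ?_, fun i hi => ?_⟩,
    fun i hi => ?_, fun i hi => ?_⟩
  · simp [hpos i hi, hi y hy]
  · simpa [hzero i hi] using abs_le.1 (abs_col_le_of_mem_faces hF hy i)
  · simp [hneg i hi, hi y hy]
  · simp [hpos i hi]
  · simp [hneg i hi]

/-- Step back from `p` by a small multiple of a strict point, staying in the projected cone, then
add that multiple again: the sum has strict signs. -/
theorem exists_strict_of_mem_interior (hF : F ∈ faces A) {p : ℝ × (Fin m → ℝ)}
    (hp : p ∈ interior (coneD A F)) :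
    ∃ x, (p.1, p.2, x) ∈ coneS A F ∧ (∀ i ∈ activePos A F, 0 < x i) ∧
      ∀ i ∈ activeNeg A F, x i < 0 := by
  obtain ⟨b, x, hx, hxp, hxn⟩ := exists_strict_mem_coneS hF
  have hc : Filter.Tendsto (fun t : ℝ => p - t • ((1 : ℝ), b)) (nhdsWithin 0 (Set.Ioi 0))
      (nhds p) := by
    have : Continuous fun t : ℝ => p - t • ((1 : ℝ), b) := by fun_prop
    have h := this.tendsto 0
    simp only [zero_smul, sub_zero] at h
    exact h.mono_left nhdsWithin_le_nhds
  obtain ⟨t, ht, ht0⟩ := ((hc.eventually (mem_interior_iff_mem_nhds.1 hp)).and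
    self_mem_nhdsWithin).exists
  replace ht0 : 0 < t := ht0
  obtain ⟨z, hz⟩ := mem_coneD.1 ht
  have h := add_mem_coneS hz (smul_mem_coneS ht0.le hx)
  refine ⟨z + t • x, ?_, fun i hi => ?_, fun i hi => ?_⟩
  · convert h using 2
    · simp
    · ext <;> simp
  · have : 0 ≤ z i := (hz.2.1 i hi).1
    have := mul_pos ht0 (hxp i hi)
    simp only [Pi.add_apply, Pi.smul_apply, smul_eq_mul]
    linarith
  · have : z i ≤ 0 := (hz.2.2.2 i hi).1
    have := mul_neg_of_pos_of_neg ht0 (hxn i hi)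
    simp only [Pi.add_apply, Pi.smul_apply, smul_eq_mul]
    linarith

theorem solutionSet_nontrivial (hA : A.rank = m) (hF : F ∈ faces A)
    (hF' : F ∉ independentFaces A) {p : ℝ × (Fin m → ℝ)} (hp : p ∈ interior (coneD A F)) :
    (solutionSet A p).Nontrivial := by
  obtain ⟨x, hx, hxp, hxn⟩ := exists_strict_of_mem_interior hF hp
  obtain ⟨w, hw, hAw, hw0⟩ := exists_ne_zero_of_not_linearIndepOn fun h => hF' ⟨hF, h⟩
  have hev : ∀ᶠ t : ℝ in nhdsWithin 0 (Set.Ioi 0), ∀ i,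
      (0 < x i → 0 < x i + t * w i) ∧ (x i < 0 → x i + t * w i < 0) := by
    refine Filter.eventually_all.2 fun i => ?_
    have hc : Filter.Tendsto (fun t : ℝ => x i + t * w i) (nhdsWithin 0 (Set.Ioi 0))
        (nhds (x i)) := by
      have : Continuous fun t : ℝ => x i + t * w i := by fun_prop
      have h := this.tendsto 0
      simp only [zero_mul, add_zero] at h
      exact h.mono_left nhdsWithin_le_nhds
    refine Filter.Eventually.and ?_ ?_
    · by_cases h : 0 < x i
      · filter_upwards [hc.eventually (lt_mem_nhds h)] with t ht _ using ht
      · exact Filter.Eventually.of_forall fun t h' => absurd h' h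
    · by_cases h : x i < 0
      · filter_upwards [hc.eventually (gt_mem_nhds h)] with t ht _ using ht
      · exact Filter.Eventually.of_forall fun t h' => absurd h' h
  obtain ⟨t, ht, ht0⟩ := (hev.and self_mem_nhdsWithin).exists
  replace ht0 : 0 < t := ht0
  have hAx : A *ᵥ (x + t • w) = A *ᵥ x := by
    rw [Matrix.mulVec_add, Matrix.mulVec_smul, hAw, smul_zero, add_zero]
  have hxw : (p.1, p.2, x + t • w) ∈ coneS A F := by
    obtain ⟨h0, h1, h2, h3⟩ := hx
    refine ⟨h0, fun i hi => ?_, fun i hi => ?_, fun i hi => ?_⟩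
    · simp only [hAx]
      exact ⟨((ht i).1 (hxp i hi)).le, (h1 i hi).2⟩
    · simp only [hAx]
      refine ⟨?_, (h2 i hi).2⟩
      have e1 : x i = 0 := (h2 i hi).1
      have e2 : w i = 0 := hw i fun h => h.elim
        (fun h => notMem_activeZero_of_mem_activePos h hi)
        (fun h => notMem_activeZero_of_mem_activeNeg h hi)
      simp [e1, e2]
    · simp only [hAx]
      exact ⟨((ht i).2 (hxn i hi)).le, (h3 i hi).2⟩
  refine ⟨x, mem_solutionSet_of_coneS hA hF hx, _, mem_solutionSet_of_coneS hA hF hxw, ?_⟩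
  intro h
  have : t • w = 0 := by simpa using h.symm
  exact hw0 ((smul_eq_zero.1 this).resolve_left ht0.ne')

/-! ### First-order optimality conditions. -/

theorem nonneg_of_forall_small_quadratic {a c δ : ℝ} (hδ : 0 < δ)
    (h : ∀ t, 0 < t → t < δ → 0 ≤ t * a + t ^ 2 * c) : 0 ≤ a := by
  have hc : Filter.Tendsto (fun t : ℝ => a + t * c) (nhdsWithin 0 (Set.Ioi 0)) (nhds a) := by
    have : Continuous fun t : ℝ => a + t * c := by fun_prop
    have h := this.tendsto 0
    simp only [zero_mul, add_zero] at h
    exact h.mono_left nhdsWithin_le_nhds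
  refine ge_of_tendsto hc ?_
  filter_upwards [Ioo_mem_nhdsGT hδ] with t ht
  have h1 := h t ht.1 ht.2
  have h2 : 0 ≤ t * (a + t * c) := by nlinarith
  exact nonneg_of_mul_nonneg_right h2 ht.1

theorem objective_add_single (lam : ℝ) (b : Fin m → ℝ) (x : Fin n → ℝ) (i : Fin n) (t : ℝ) :
    objective A lam b (x + t • Pi.single i 1) = objective A lam b x + (|x i + t| - |x i|) +
      1 / (2 * lam) * (t ^ 2 * (A.col i ⬝ᵥ A.col i) -
        2 * t * (A.col i ⬝ᵥ (b - A *ᵥ x))) := by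
  have e : A *ᵥ (x + t • Pi.single i 1) = A *ᵥ x + t • A.col i := by
    rw [Matrix.mulVec_add, Matrix.mulVec_smul, Matrix.mulVec_single_one]
  have e2 : ∑ j, |(x + t • Pi.single i 1 : Fin n → ℝ) j| =
      ∑ j, |x j| + (|x i + t| - |x i|) := by
    rw [← sub_eq_iff_eq_add', ← Finset.sum_sub_distrib,
      Finset.sum_eq_single i (by intro j _ hj; simp [hj]) (by simp)]
    simp
  rw [objective_eq, objective_eq, e, e2]
  simp only [sub_dotProduct, dotProduct_sub, add_dotProduct, dotProduct_add, smul_dotProduct,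
    dotProduct_smul, smul_eq_mul]
  rw [dotProduct_comm (A *ᵥ x) (A.col i), dotProduct_comm b (A.col i),
    dotProduct_comm b (A *ᵥ x)]
  ring

theorem optimality_conditions {p : ℝ × (Fin m → ℝ)} {x : Fin n → ℝ} (hp : 0 < p.1)
    (hx : ∀ z, objective A p.1 p.2 x ≤ objective A p.1 p.2 z) (i : Fin n) :
    (0 < x i → A.col i ⬝ᵥ (p.2 - A *ᵥ x) = p.1) ∧
    (x i = 0 → -p.1 ≤ A.col i ⬝ᵥ (p.2 - A *ᵥ x) ∧ A.col i ⬝ᵥ (p.2 - A *ᵥ x) ≤ p.1) ∧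
    (x i < 0 → A.col i ⬝ᵥ (p.2 - A *ᵥ x) = -p.1) := by
  set c := A.col i ⬝ᵥ (p.2 - A *ᵥ x)
  have key : ∀ t, 0 ≤ 2 * p.1 * (|x i + t| - |x i|) + t ^ 2 * (A.col i ⬝ᵥ A.col i) -
      2 * t * c := by
    intro t
    have h := hx (x + t • Pi.single i 1)
    rw [objective_add_single] at h
    have h2 : 0 ≤ (|x i + t| - |x i|) +
      1 / (2 * p.1) * (t ^ 2 * (A.col i ⬝ᵥ A.col i) - 2 * t * c) := by linarith
    have h3 := mul_nonneg (by positivity : 0 ≤ 2 * p.1) h2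
    rw [mul_add, ← mul_assoc, mul_one_div_cancel (by positivity), one_mul] at h3
    linarith
  have up : 0 ≤ x i → c ≤ p.1 := by
    intro h0
    have := nonneg_of_forall_small_quadratic (a := 2 * p.1 - 2 * c) (c := A.col i ⬝ᵥ A.col i)
      one_pos (fun t ht _ => by
        have h := key t
        rw [abs_of_nonneg h0, abs_of_nonneg (by linarith)] at h
        nlinarith)
    linarith
  have down : x i ≤ 0 → -p.1 ≤ c := by
    intro h0
    have := nonneg_of_forall_small_quadratic (a := 2 * p.1 + 2 * c) (c := A.col i ⬝ᵥ A.col i)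
      one_pos (fun t ht _ => by
        have h := key (-t)
        rw [abs_of_nonpos h0, abs_of_nonpos (by linarith)] at h
        nlinarith)
    linarith
  refine ⟨fun h0 => le_antisymm (up h0.le) ?_, fun h0 => ⟨down h0.le, up h0.ge⟩,
    fun h0 => le_antisymm ?_ (down h0.le)⟩
  -- Moving towards zero by less than `x i` keeps the sign, so the absolute value remains linear.
  · have := nonneg_of_forall_small_quadratic (a := -(2 * p.1) + 2 * c)
      (c := A.col i ⬝ᵥ A.col i) h0 (fun t ht ht' => by
        have h := key (-t)
        rw [abs_of_nonneg h0.le, abs_of_nonneg (by linarith)] at h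
        nlinarith)
    linarith
  · have := nonneg_of_forall_small_quadratic (a := -(2 * p.1) - 2 * c)
      (c := A.col i ⬝ᵥ A.col i) (neg_pos.2 h0) (fun t ht ht' => by
        have h := key t
        rw [abs_of_nonpos h0.le, abs_of_nonpos (by linarith)] at h
        nlinarith)
    linarith

/-! ### From uniqueness to a strict dual certificate. -/

theorem abs_sum_lt_of_solutionSet_eq_singleton {p : ℝ × (Fin m → ℝ)} {x : Fin n → ℝ}
    (h : solutionSet A p = {x}) {z : Fin n → ℝ} (hz : A *ᵥ z = A *ᵥ x) (hne : z ≠ x) :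
    ∑ i, |x i| < ∑ i, |z i| := by
  by_contra! hle
  have hx : x ∈ solutionSet A p := h ▸ Set.mem_singleton x
  have hzS : z ∈ solutionSet A p := by
    rcases hx with ⟨hp, hx⟩ | ⟨hp, hb, hx⟩
    · refine Or.inl ⟨hp, fun v => le_trans ?_ (hx v)⟩
      rw [objective_eq, objective_eq, hz]
      linarith
    · refine Or.inr ⟨hp, hz.trans hb, fun v hv => le_trans ?_ (hx v hv)⟩
      rwa [norm_toLp_one, norm_toLp_one]
  rw [h] at hzS
  exact hne hzS

/-- The derivative of the smooth part of the `ℓ¹` norm at `x`. -/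
noncomputable def signForm (x : Fin n → ℝ) : (Fin n → ℝ) →ₗ[ℝ] ℝ :=
  ∑ i, Real.sign (x i) • LinearMap.proj i

theorem signForm_apply (x w : Fin n → ℝ) : signForm x w = ∑ i, Real.sign (x i) * w i := by
  simp [signForm]

/-- The `ℓ¹` norm of the coordinates at which `x` vanishes. -/
noncomputable def offSupportNorm (x w : Fin n → ℝ) : ℝ :=
  ∑ i, if x i = 0 then |w i| else 0

theorem offSupportNorm_smul {c : ℝ} (x w : Fin n → ℝ) :
    offSupportNorm x (c • w) = |c| * offSupportNorm x w := by
  simp only [offSupportNorm, Finset.mul_sum, Pi.smul_apply, smul_eq_mul, abs_mul, mul_ite,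
    mul_zero]

theorem offSupportNorm_add (x w v : Fin n → ℝ) :
    offSupportNorm x (w + v) ≤ offSupportNorm x w + offSupportNorm x v := by
  simp only [offSupportNorm, ← Finset.sum_add_distrib]
  refine Finset.sum_le_sum fun i _ => ?_
  split_ifs
  · exact abs_add_le _ _
  · simp

theorem offSupportNorm_single (x : Fin n → ℝ) (i : Fin n) :
    offSupportNorm x (Pi.single i 1) = if x i = 0 then 1 else 0 := by
  rw [offSupportNorm, Finset.sum_eq_single i (by intro j _ hj; simp [hj]) (by simp)]
  simp

theorem signForm_single (x : Fin n → ℝ) (i : Fin n) :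
    signForm x (Pi.single i 1) = Real.sign (x i) := by
  rw [signForm_apply, Finset.sum_eq_single i (by intro j _ hj; simp [hj]) (by simp)]
  simp

theorem continuous_offSupportNorm (x : Fin n → ℝ) : Continuous (offSupportNorm x) := by
  refine continuous_finsetSum _ fun i _ => ?_
  split_ifs
  · fun_prop
  · exact continuous_const

theorem exists_abs_sum_add_smul (x w : Fin n → ℝ) : ∃ t : ℝ, 0 < t ∧
    ∑ i, |(x + t • w) i| = ∑ i, |x i| + t * (signForm x w + offSupportNorm x w) := by
  have hev : ∀ᶠ t : ℝ in nhdsWithin 0 (Set.Ioi 0), ∀ i,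
      |(x + t • w) i| = |x i| + t * (Real.sign (x i) * w i + if x i = 0 then |w i| else 0) := by
    refine Filter.eventually_all.2 fun i => ?_
    have hc : Filter.Tendsto (fun t : ℝ => x i + t * w i) (nhdsWithin 0 (Set.Ioi 0))
        (nhds (x i)) := by
      have : Continuous fun t : ℝ => x i + t * w i := by fun_prop
      have h := this.tendsto 0
      simp only [zero_mul, add_zero] at h
      exact h.mono_left nhdsWithin_le_nhds
    rcases lt_trichotomy (x i) 0 with h | h | h
    · filter_upwards [hc.eventually (gt_mem_nhds h)] with t ht
      simp only [Pi.add_apply, Pi.smul_apply, smul_eq_mul]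
      rw [abs_of_neg ht, abs_of_neg h, Real.sign_of_neg h, if_neg h.ne]
      ring
    · filter_upwards [self_mem_nhdsWithin] with t ht
      replace ht : 0 < t := ht
      simp [h, abs_mul, abs_of_pos ht]
    · filter_upwards [hc.eventually (lt_mem_nhds h)] with t ht
      simp only [Pi.add_apply, Pi.smul_apply, smul_eq_mul]
      rw [abs_of_pos ht, abs_of_pos h, Real.sign_of_pos h, if_neg h.ne']
      ring
  obtain ⟨t, ht, ht0⟩ := (hev.and self_mem_nhdsWithin).exists
  refine ⟨t, ht0, ?_⟩
  rw [signForm_apply, offSupportNorm, ← Finset.sum_add_distrib, Finset.mul_sum,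
    ← Finset.sum_add_distrib]
  exact Finset.sum_congr rfl fun i _ => ht i

/-- The one-sided derivative of the `ℓ¹` norm is positive along both `w` and `-w`. -/
theorem abs_signForm_lt {x : Fin n → ℝ}
    (hx : ∀ z, A *ᵥ z = A *ᵥ x → z ≠ x → ∑ i, |x i| < ∑ i, |z i|) {w : Fin n → ℝ}
    (hw : A *ᵥ w = 0) (hw0 : w ≠ 0) : |signForm x w| < offSupportNorm x w := by
  have key : ∀ v : Fin n → ℝ, A *ᵥ v = 0 → v ≠ 0 → 0 < signForm x v + offSupportNorm x v := by
    intro v hv hv0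
    obtain ⟨t, ht, h⟩ := exists_abs_sum_add_smul x v
    have h1 := hx (x + t • v) (by rw [Matrix.mulVec_add, Matrix.mulVec_smul, hv]; simp)
      (by simp [ht.ne', hv0])
    rw [h] at h1
    exact pos_of_mul_pos_right (by linarith) ht.le
  have h1 := key w hw hw0
  have h2 := key (-w) (by rw [Matrix.mulVec_neg, hw, neg_zero]) (neg_ne_zero.2 hw0)
  have h3 : offSupportNorm x (-w) = offSupportNorm x w := by simp [offSupportNorm]
  rw [map_neg, h3] at h2
  exact abs_lt.2 ⟨by linarith, by linarith⟩

/-- The ratio of the two sides is scale invariant and attains its maximum, below `1`, on the compact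
unit sphere of the kernel. -/
theorem exists_contraction_bound {x : Fin n → ℝ}
    (hx : ∀ w, A *ᵥ w = 0 → w ≠ 0 → |signForm x w| < offSupportNorm x w) :
    ∃ θ : ℝ, 0 ≤ θ ∧ θ < 1 ∧ ∀ w, A *ᵥ w = 0 → |signForm x w| ≤ θ * offSupportNorm x w := by
  set K : Set (Fin n → ℝ) := {w | A *ᵥ w = 0} ∩ Metric.sphere 0 1
  have hKc : IsCompact K := by
    refine (isCompact_sphere (0 : Fin n → ℝ) 1).inter_left ?_
    exact isClosed_eq (by fun_prop) continuous_const
  have hK0 : ∀ w ∈ K, w ≠ 0 := fun w hw => by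
    have h : ‖w‖ = 1 := by simpa using hw.2
    exact norm_ne_zero_iff.1 (by rw [h]; exact one_ne_zero)
  have hpos : ∀ w, A *ᵥ w = 0 → w ≠ 0 → 0 < offSupportNorm x w := fun w hw hw0 =>
    (abs_nonneg _).trans_lt (hx w hw hw0)
  have hcont : Continuous (signForm x) := (signForm x).continuous_of_finiteDimensional
  obtain ⟨θ, hθ0, hθ1, hθ⟩ : ∃ θ : ℝ, 0 ≤ θ ∧ θ < 1 ∧
      ∀ w ∈ K, |signForm x w| / offSupportNorm x w ≤ θ := by
    rcases K.eq_empty_or_nonempty with h | h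
    · exact ⟨0, le_rfl, one_pos, by simp [h]⟩
    · obtain ⟨v, hv, hmax⟩ := hKc.exists_isMaxOn h
        (f := fun w => |signForm x w| / offSupportNorm x w)
        (hcont.abs.continuousOn.div (continuous_offSupportNorm x).continuousOn
          fun w hw => (hpos w hw.1 (hK0 w hw)).ne')
      exact ⟨_, div_nonneg (abs_nonneg _) (hpos v hv.1 (hK0 v hv)).le,
        (div_lt_one (hpos v hv.1 (hK0 v hv))).2 (hx v hv.1 (hK0 v hv)), fun w hw => hmax hw⟩
  refine ⟨θ, hθ0, hθ1, fun w hw => ?_⟩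
  by_cases hw0 : w = 0
  · simp [hw0, offSupportNorm]
  have hn : 0 < ‖w‖ := norm_pos_iff.2 hw0
  have hmem : ‖w‖⁻¹ • w ∈ K :=
    ⟨by simp [Matrix.mulVec_smul, hw], by simp [norm_smul, hn.ne']⟩
  have h := hθ _ hmem
  rwa [map_smul, smul_eq_mul, abs_mul, offSupportNorm_smul,
    mul_div_mul_left _ _ (abs_pos.2 (inv_pos.2 hn).ne').ne', div_le_iff₀ (hpos w hw hw0)] at h

/-- A functional that vanishes on the kernel of `A` factors through `A`. -/
theorem exists_dotProduct_eq_of_ker_le {ψ : (Fin n → ℝ) →ₗ[ℝ] ℝ}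
    (h : ∀ w, A *ᵥ w = 0 → ψ w = 0) : ∃ y : Fin m → ℝ, ∀ i, A.col i ⬝ᵥ y = ψ (Pi.single i 1) := by
  have hmem : ψ ∈ LinearMap.range A.mulVecLin.dualMap := by
    rw [LinearMap.range_dualMap_eq_dualAnnihilator_ker, Submodule.mem_dualAnnihilator]
    exact fun w hw => h w hw
  obtain ⟨l, rfl⟩ := hmem
  refine ⟨fun j => l (Pi.single j 1), fun i => ?_⟩
  rw [LinearMap.dualMap_apply, Matrix.mulVecLin_apply, Matrix.mulVec_single_one,
    LinearMap.pi_apply_eq_sum_univ l]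
  simp only [dotProduct, smul_eq_mul]
  refine Finset.sum_congr rfl fun j _ => ?_
  congr 2
  ext k
  simp [Pi.single_apply, eq_comm]

/-- A unique minimizer has a dual certificate that is strict off its support. -/
theorem exists_strict_certificate {x : Fin n → ℝ}
    (hx : ∀ w, A *ᵥ w = 0 → w ≠ 0 → |signForm x w| < offSupportNorm x w) :
    ∃ y : Fin m → ℝ, ∀ i, (x i ≠ 0 → A.col i ⬝ᵥ y = Real.sign (x i)) ∧
      (x i = 0 → |A.col i ⬝ᵥ y| < 1) := by
  obtain ⟨θ, hθ0, hθ1, hθ⟩ := exists_contraction_bound hx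
  -- Hahn–Banach extends `-signForm x` from the kernel. The bound makes `φ` vanish on support
  -- coordinates and stay below `1` in absolute value on the others, while `signForm x + φ` kills
  -- the kernel.
  obtain ⟨φ, hφ, hφN⟩ := exists_extension_of_le_sublinear
    ⟨LinearMap.ker A.mulVecLin, (-signForm x).comp (Submodule.subtype _)⟩
    (fun w => θ * offSupportNorm x w)
    (fun c hc w => by rw [offSupportNorm_smul, abs_of_pos hc]; ring)
    (fun w v => by
      rw [← mul_add]
      exact mul_le_mul_of_nonneg_left (offSupportNorm_add x w v) hθ0)
    (fun w => (neg_le_abs _).trans (hθ w w.2))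
  have habs : ∀ w, |φ w| ≤ θ * offSupportNorm x w := fun w => by
    refine abs_le'.2 ⟨hφN w, ?_⟩
    have h := hφN (-w)
    rw [map_neg] at h
    simpa [offSupportNorm] using h
  obtain ⟨y, hy⟩ := exists_dotProduct_eq_of_ker_le (A := A) (ψ := signForm x + φ) (by
    intro w hw
    have h : φ w = -signForm x w := hφ ⟨w, hw⟩
    rw [LinearMap.add_apply, h, add_neg_cancel])
  refine ⟨y, fun i => ?_⟩
  have h := habs (Pi.single i 1)
  rw [offSupportNorm_single] at h
  rw [hy, LinearMap.add_apply, signForm_single]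
  constructor
  · intro hi
    rw [if_neg hi, mul_zero] at h
    rw [abs_nonpos_iff.1 h, add_zero]
  · intro hi
    rw [if_pos hi, mul_one] at h
    rw [hi, Real.sign_zero, zero_add]
    exact h.trans_lt hθ1

/-! ### The face determined by a sign pattern. -/

theorem abs_col_le_of_mem_signFace {x : Fin n → ℝ} {y : Fin m → ℝ} (hy : y ∈ signFace A x)
    (i : Fin n) : |A.col i ⬝ᵥ y| ≤ 1 := by
  obtain ⟨h1, h2, h3⟩ := hy
  rcases lt_trichotomy (x i) 0 with h | h | h
  · simp [h3 i h]
  · exact abs_le.2 (h2 i h)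
  · simp [h1 i h]

theorem dotProduct_mulVec_eq_of_mem_signFace {x : Fin n → ℝ} {y : Fin m → ℝ}
    (hy : y ∈ signFace A x) : y ⬝ᵥ (A *ᵥ x) = ∑ i, |x i| := by
  obtain ⟨h1, h2, h3⟩ := hy
  rw [dotProduct_mulVec_eq_sum]
  refine Finset.sum_congr rfl fun i _ => ?_
  rcases lt_trichotomy (x i) 0 with h | h | h
  · simp [h3 i h, abs_of_neg h]
  · simp [h]
  · simp [h1 i h, abs_of_pos h]

theorem mem_signFace_of_dotProduct_mulVec_eq {x : Fin n → ℝ} {y : Fin m → ℝ}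
    (hy : y ∈ dualFeasible A) (h : ∑ i, |x i| ≤ y ⬝ᵥ (A *ᵥ x)) : y ∈ signFace A x := by
  rw [mem_dualFeasible] at hy
  have hle : ∀ j ∈ Finset.univ, (A.col j ⬝ᵥ y) * x j ≤ |x j| := fun j _ => by
    refine (le_abs_self _).trans ?_
    rw [abs_mul]
    exact mul_le_of_le_one_left (abs_nonneg _) (hy j)
  rw [dotProduct_mulVec_eq_sum] at h
  have he := (Finset.sum_eq_sum_iff_of_le hle).1 (le_antisymm (Finset.sum_le_sum hle) h)
  refine ⟨fun i hi => ?_, fun i _ => abs_le.1 (hy i), fun i hi => ?_⟩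
  · have := he i (Finset.mem_univ i)
    rw [abs_of_pos hi] at this
    exact (mul_eq_right₀ hi.ne').1 this
  · have := he i (Finset.mem_univ i)
    rw [abs_of_neg hi, ← neg_one_mul] at this
    exact mul_right_cancel₀ hi.ne this

/-- The exposing functional is pairing with `A x`: its maximum over the dual feasible set is `‖x‖₁`,
attained exactly on the sign face. -/
theorem signFace_mem_faces {x : Fin n → ℝ} (h : (signFace A x).Nonempty) :
    signFace A x ∈ faces A := by
  refine ⟨h, fun _ => ?_⟩
  obtain ⟨y₀, hy₀⟩ := h
  let l : (Fin m → ℝ) →ₗ[ℝ] ℝ := dotProductBilin ℝ ℝ (A *ᵥ x)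
  have hl : ∀ y, l y = y ⬝ᵥ (A *ᵥ x) := fun y => by
    rw [dotProduct_comm]
    rfl
  refine ⟨LinearMap.toContinuousLinearMap l, Set.ext fun y => ⟨fun hy => ⟨?_, fun z hz => ?_⟩,
    fun hy => ?_⟩⟩
  · exact mem_dualFeasible.2 (abs_col_le_of_mem_signFace hy)
  · simp only [LinearMap.coe_toContinuousLinearMap', hl]
    rw [dotProduct_mulVec_eq_of_mem_signFace hy]
    simpa using dotProduct_mulVec_le (mem_dualFeasible.1 hz) x
  · refine mem_signFace_of_dotProduct_mulVec_eq hy.1 ?_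
    have := hy.2 y₀ (mem_dualFeasible.2 (abs_col_le_of_mem_signFace hy₀))
    simp only [LinearMap.coe_toContinuousLinearMap', hl] at this
    rwa [dotProduct_mulVec_eq_of_mem_signFace hy₀] at this

theorem active_signFace {x : Fin n → ℝ} {y : Fin m → ℝ}
    (hy : ∀ i, (x i ≠ 0 → A.col i ⬝ᵥ y = Real.sign (x i)) ∧ (x i = 0 → |A.col i ⬝ᵥ y| < 1)) :
    y ∈ signFace A x ∧ activePos A (signFace A x) = {i | 0 < x i} ∧
      activeZero A (signFace A x) = {i | x i = 0} ∧
      activeNeg A (signFace A x) = {i | x i < 0} := by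
  have hyF : y ∈ signFace A x := by
    refine ⟨fun i hi => ?_, fun i hi => abs_le.1 ((hy i).2 hi).le, fun i hi => ?_⟩
    · rw [(hy i).1 hi.ne', Real.sign_of_pos hi]
    · rw [(hy i).1 hi.ne, Real.sign_of_neg hi]
  have hF := signFace_mem_faces ⟨y, hyF⟩
  have hp : ∀ i, 0 < x i → i ∈ activePos A (signFace A x) := fun i hi z hz => hz.1 i hi
  have hn : ∀ i, x i < 0 → i ∈ activeNeg A (signFace A x) := fun i hi z hz => hz.2.2 i hi
  have hz : ∀ i, x i = 0 → i ∈ activeZero A (signFace A x) := fun i hi =>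
    ⟨y, hyF, abs_lt.1 ((hy i).2 hi)⟩
  refine ⟨hyF, Set.ext fun i => ⟨fun h => ?_, hp i⟩, Set.ext fun i => ⟨fun h => ?_, hz i⟩,
    Set.ext fun i => ⟨fun h => ?_, hn i⟩⟩ <;> rcases lt_trichotomy (x i) 0 with hi | hi | hi
  · exact absurd (hn i hi) (notMem_activeNeg_of_mem_activePos hF.1 h)
  · exact absurd (hz i hi) (notMem_activeZero_of_mem_activePos h)
  · exact hi
  · exact absurd h (notMem_activeZero_of_mem_activeNeg (hn i hi))
  · exact hi
  · exact absurd h (notMem_activeZero_of_mem_activePos (hp i hi))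
  · exact hi
  · exact absurd (hz i hi) (notMem_activeZero_of_mem_activeNeg h)
  · exact absurd h (notMem_activeNeg_of_mem_activePos hF.1 (hp i hi))

/-- A dependence would be a nonzero kernel vector supported where `x` is nonzero, with zero
off-support norm. -/
theorem linearIndepOn_support {x : Fin n → ℝ}
    (hx : ∀ w, A *ᵥ w = 0 → w ≠ 0 → |signForm x w| < offSupportNorm x w) :
    LinearIndepOn ℝ A.col ({i | 0 < x i} ∪ {i | x i < 0}) := by
  by_contra h
  obtain ⟨w, hw, hAw, hw0⟩ := exists_ne_zero_of_not_linearIndepOn h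
  have h1 := hx w hAw hw0
  have h2 : offSupportNorm x w = 0 := by
    refine Finset.sum_eq_zero fun i _ => ?_
    split_ifs with hi
    · rw [hw i (by simp [hi]), abs_zero]
    · rfl
  rw [h2] at h1
  exact absurd h1 (abs_nonneg _).not_gt

/-! ### Polyhedrality and conclusion. -/

/-- A finite system of homogeneous linear inequalities defines a polyhedral cone. -/
theorem isPolyhedralCone_of_forall_le {E ι : Type*} [AddCommGroup E] [Module ℝ E] [Fintype ι]
    {C : Set E} (a : ι → (E →ₗ[ℝ] ℝ)) (hC : ∀ z, z ∈ C ↔ ∀ j, a j z ≤ 0) :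
    IsPolyhedralCone C := by
  refine ⟨⟨Fintype.card ι, fun k => a ((Fintype.equivFin ι).symm k), 0, Set.ext fun z => ?_⟩,
    ?_, fun t ht z hz => ?_⟩
  · rw [hC]
    exact ⟨fun h k => h _, fun h j => by simpa using h (Fintype.equivFin ι j)⟩
  · simp [hC]
  · rw [hC] at hz ⊢
    intro j
    rw [map_smul, smul_eq_mul]
    exact mul_nonpos_of_nonneg_of_nonpos ht.le (hz j)

/-- The pairing of the `i`-th column with the residual `b - A (L (λ, b))`, as a linear functional of
`(λ, b)`. -/
def residualForm (A : Matrix (Fin m) (Fin n) ℝ) (L : ℝ × (Fin m → ℝ) →ₗ[ℝ] (Fin n → ℝ))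
    (i : Fin n) : ℝ × (Fin m → ℝ) →ₗ[ℝ] ℝ :=
  (dotProductBilin ℝ ℝ (A.col i)).comp (LinearMap.snd ℝ ℝ (Fin m → ℝ) - A.mulVecLin.comp L)

/-- Independence gives `x = L p`, so the projection is the preimage of the cone under a linear map
and no variable has to be eliminated. -/
theorem isPolyhedralCone_coneD (hF : F ∈ independentFaces A) :
    IsPolyhedralCone (coneD A F) := by
  classical
  obtain ⟨L, hL⟩ := exists_linear_solution hF
  let f : ℝ × (Fin m → ℝ) →ₗ[ℝ] ℝ := LinearMap.fst ℝ ℝ (Fin m → ℝ)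
  let g : Fin n → (ℝ × (Fin m → ℝ) →ₗ[ℝ] ℝ) := fun i => (LinearMap.proj i).comp L
  let r := residualForm A L
  -- `none` encodes `λ ≥ 0`; `j` selects the active class and `k` one of its inequalities, with
  -- equations split in two and unused slots filled by `0`.
  let a : Option (Fin n × Fin 4 × Fin 3) → (ℝ × (Fin m → ℝ) →ₗ[ℝ] ℝ) := fun k =>
    match k with
    | none => -f
    | some (i, k, j) =>
      if (j = 0 ∧ i ∈ activePos A F) then ![-g i, r i - f, f - r i, 0] k
      else if (j = 1 ∧ i ∈ activeZero A F) then ![g i, -g i, -f - r i, r i - f] k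
      else if (j = 2 ∧ i ∈ activeNeg A F) then ![g i, r i + f, -f - r i, 0] k
      else 0
  refine isPolyhedralCone_of_forall_le a fun p => ?_
  have hmem : p ∈ coneD A F ↔ (p.1, p.2, L p) ∈ coneS A F := by
    rw [mem_coneD]
    refine ⟨fun ⟨x, hx⟩ => ?_, fun h => ⟨_, h⟩⟩
    rwa [← hL p x (solvesSystem_of_coneS hx)]
  have hg : ∀ i, g i p = L p i := fun i => rfl
  have hr : ∀ i, r i p = A.col i ⬝ᵥ (p.2 - A *ᵥ L p) := fun i => rfl
  have hf : f p = p.1 := rfl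
  have e0 : (∀ k, a k p ≤ 0) ↔ 0 ≤ f p ∧ ∀ i k j, a (some (i, k, j)) p ≤ 0 := by
    rw [Option.forall]
    simp [a]
  rw [hmem, e0]
  simp only [coneS, Set.mem_ofPred_eq, ← hg, ← hr]
  rw [← hf]
  refine and_congr Iff.rfl ⟨?_, ?_⟩
  · rintro ⟨h1, h2, h3⟩ i k j
    simp only [a]
    split_ifs with hi hi hi
    · have := h1 i hi.2
      fin_cases k <;> simp <;> linarith
    · have := h2 i hi.2
      fin_cases k <;> simp <;> linarith
    · have := h3 i hi.2
      fin_cases k <;> simp <;> linarith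
    · simp
  · intro h
    refine ⟨fun i hi => ?_, fun i hi => ?_, fun i hi => ?_⟩
    · have k0 := h i 0 0
      have k1 := h i 1 0
      have k2 := h i 2 0
      simp [a, hi] at k0 k1 k2
      exact ⟨k0, le_antisymm k1 k2⟩
    · have k0 := h i 0 1
      have k1 := h i 1 1
      have k2 := h i 2 1
      have k3 := h i 3 1
      simp [a, hi] at k0 k1 k2 k3
      refine ⟨?_, ?_, ?_⟩ <;> linarith
    · have k0 := h i 0 2
      have k1 := h i 1 2
      have k2 := h i 2 2
      simp [a, hi] at k0 k1 k2
      refine ⟨?_, ?_⟩ <;> linarith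

theorem mem_coneD_signFace {p : ℝ × (Fin m → ℝ)} {x : Fin n → ℝ} (hx : x ∈ solutionSet A p)
    (hpos : activePos A (signFace A x) = {i | 0 < x i})
    (hzero : activeZero A (signFace A x) = {i | x i = 0})
    (hneg : activeNeg A (signFace A x) = {i | x i < 0}) : p ∈ coneD A (signFace A x) := by
  refine mem_coneD.2 ⟨x, ?_⟩
  simp only [coneS, hpos, hzero, hneg, Set.mem_ofPred_eq]
  rcases hx with ⟨hp, hx⟩ | ⟨hp, hb, -⟩
  · have h := optimality_conditions hp hx
    exact ⟨hp.le, fun i hi => ⟨hi.le, (h i).1 hi⟩, fun i hi => ⟨hi, (h i).2.1 hi⟩,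
      fun i hi => ⟨hi.le, (h i).2.2 hi⟩⟩
  · have hr : p.2 - A *ᵥ x = 0 := by rw [hb, sub_self]
    simp only [hr, hp, dotProduct_zero, neg_zero, le_refl, and_true]
    exact ⟨trivial, fun i hi => hi.le, fun i hi => hi, fun i hi => hi.le⟩

theorem signFace_mem_independentFaces {p : ℝ × (Fin m → ℝ)} {x : Fin n → ℝ}
    (h : solutionSet A p = {x}) :
    signFace A x ∈ independentFaces A ∧ p ∈ coneD A (signFace A x) := by
  have hw : ∀ w, A *ᵥ w = 0 → w ≠ 0 → |signForm x w| < offSupportNorm x w := fun w hw hw0 =>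
    abs_signForm_lt (fun z hz hne => abs_sum_lt_of_solutionSet_eq_singleton h hz hne) hw hw0
  obtain ⟨y, hy⟩ := exists_strict_certificate hw
  obtain ⟨hyF, hpos, hzero, hneg⟩ := active_signFace hy
  refine ⟨⟨signFace_mem_faces ⟨y, hyF⟩, ?_⟩,
    mem_coneD_signFace (h ▸ Set.mem_singleton x) hpos hzero hneg⟩
  rw [hpos, hneg]
  exact linearIndepOn_support hw

end L1Reg

theorem mainTheorem7 {m n : ℕ} (A : Matrix (Fin m) (Fin n) ℝ) (hA : A.rank = m) :
    (∀ F ∈ L1Reg.independentFaces A,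
      L1Reg.SingleValuedLinearOn (L1Reg.solutionSet A) (L1Reg.coneD A F) ∧
      ∀ p ∈ L1Reg.coneD A F, ∃ x : Fin n → ℝ,
        L1Reg.solutionSet A p = {x} ∧ L1Reg.SolvesSystem A F p x ∧
        ∀ x' : Fin n → ℝ, L1Reg.SolvesSystem A F p x' → x' = x) ∧
    (∀ F ∈ L1Reg.faces A, F ∉ L1Reg.independentFaces A →
      ∀ p ∈ interior (L1Reg.coneD A F), (L1Reg.solutionSet A p).Nontrivial) ∧
    (∀ (p : ℝ × (Fin m → ℝ)) (x : Fin n → ℝ), L1Reg.solutionSet A p = {x} →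
      L1Reg.signFace A x ∈ L1Reg.faces A ∧
      L1Reg.IsPolyhedralCone (L1Reg.coneD A (L1Reg.signFace A x)) ∧
      p ∈ L1Reg.coneD A (L1Reg.signFace A x) ∧
      L1Reg.SingleValuedLinearOn (L1Reg.solutionSet A)
        (L1Reg.coneD A (L1Reg.signFace A x))) := by

  refine ⟨fun F hF => ⟨L1Reg.singleValuedLinearOn_coneD hA hF, fun p hp => ?_⟩,
    fun F hF hF' p hp => L1Reg.solutionSet_nontrivial hA hF hF' hp, fun p x h => ?_⟩
  · obtain ⟨x, hx⟩ := L1Reg.mem_coneD.1 hp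
    exact ⟨x, L1Reg.solutionSet_eq_singleton hA hF hx, L1Reg.solvesSystem_of_coneS hx,
      fun x' hx' => (L1Reg.solvesSystem_of_coneS hx).unique hF hx'⟩
  · obtain ⟨hF, hp⟩ := L1Reg.signFace_mem_independentFaces h
    exact ⟨hF.1, L1Reg.isPolyhedralCone_coneD hF, hp, L1Reg.singleValuedLinearOn_coneD hA hF⟩
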